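/- Let $d\ge 1$, let $f:\mathbb{R}^d\to\mathbb{R}$ be twice continuously differentiable and bounded below, with $\|\nabla f(x)-\nabla f(y)\|\le L_1\|x-y\|$ and $\|\nabla^2 f(x)-\nabla^2 f(y)\|\le L_2\|x-y\|$ for all $x,y$ (Euclidean norm and operator norm; $L_1,L_2>0$). For $\epsilon,\gamma>0$, a point $x$ is an $(\epsilon,\gamma)$-second-order stationary point if $\|\nabla f(x)\|\le\epsilon$ and $\lambda_{\min}(\nabla^2 f(x))\ge-\gamma$. Two-step random search with radii $\sigma_1,\sigma_2>0$ starts from a (possibly random) point $x_0$. In step $k=0,1,2,\dots$ it draws $s_k$ uniformly from the unit sphere of $\mathbb{R}^d$, independently of the past, and chooses $x_{k+1}$ as a minimizer of $f$ among $x_k,\ x_k+\sigma s_k,\ x_k-\sigma s_k$, where $\sigma=\sigma_1$ for even $k$ and $\sigma=\sigma_2$ for odd $k$ (ties are broken in any way that does not depend on future draws). Each step costs three function evaluations. Let $N\in\{0,3,6,\dots\}\cup\{\infty\}$ be the number of function evaluations performed until the first iterate $x_k$, $k\ge0$, that is an $(\epsilon,\epsilon^{2/3})$-second-order stationary point. Theorem.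 There are universal constants $C,c>0$ such that for all $d,f,L_1,L_2$ as above and every $\epsilon>0$, two-step random search with $$\sigma_1=\frac{\epsilon}{L_1\sqrt{2\pi d}},\qquad \sigma_2=\frac{\epsilon^{2/3}}{2L_2}$$ satisfies $$\mathbb{E}[N]\ \le\ C\,\bigl(\min\{L_1,\epsilon^{2/3}\}+L_2^2\bigr)\,\mathbb{E}\Bigl[f(x_0)-\inf_{\mathbb{R}^d} f\Bigr]\;\kappa^{d}\,\epsilon^{-2},\qquad \kappa=c\,\max\{1,\,L_1\epsilon^{-2/3}\}.$$ In particular $\kappa=c\,L_1\epsilon^{-2/3}$ whenever $\epsilon^{2/3}\le L_1$, and for $\epsilon\le1$ the constant hidden in $\mathbb{E}[N]=\mathcal{O}(\kappa^d\epsilon^{-2})$ depends only on $L_2$ and $\mathbb{E}[f(x_0)]-\inf f$. -/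

import Mathlib

open MeasureTheory ProbabilityTheory
open scoped ENNReal

namespace RandomSearch

/-- The Hessian of `f` at `x`, as the derivative of the gradient. -/
noncomputable def hessian {d : ℕ} (f : EuclideanSpace ℝ (Fin d) → ℝ)
    (x : EuclideanSpace ℝ (Fin d)) :
    EuclideanSpace ℝ (Fin d) →L[ℝ] EuclideanSpace ℝ (Fin d) :=
  fderiv ℝ (gradient f) x

/-- The smallest (real) eigenvalue of a linear operator. It is applied to Hessians of `C^2`
functions in dimension at least one: these are symmetric, so the set of eigenvalues is finite and
nonempty. -/
noncomputable def lambdaMin {d : ℕ}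
    (A : EuclideanSpace ℝ (Fin d) →L[ℝ] EuclideanSpace ℝ (Fin d)) : ℝ :=
  sInf {μ : ℝ | Module.End.HasEigenvalue
    (A : EuclideanSpace ℝ (Fin d) →ₗ[ℝ] EuclideanSpace ℝ (Fin d)) μ}

/-- `(ε, γ)`-second-order stationary points. -/
def IsSOSP {d : ℕ} (f : EuclideanSpace ℝ (Fin d) → ℝ) (ε γ : ℝ)
    (x : EuclideanSpace ℝ (Fin d)) : Prop :=
  ‖gradient f x‖ ≤ ε ∧ -γ ≤ lambdaMin (hessian f x)

/-- `f` is twice continuously differentiable, bounded below, `L₁`-smooth (Lipschitz gradient), and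
its Hessian is `L₂`-Lipschitz for the operator norm. -/
structure SmoothnessAssumption {d : ℕ} (f : EuclideanSpace ℝ (Fin d) → ℝ) (L₁ L₂ : ℝ) :
    Prop where
  contDiff : ContDiff ℝ 2 f
  bddBelow : BddBelow (Set.range f)
  smooth : ∀ x y, ‖gradient f x - gradient f y‖ ≤ L₁ * ‖x - y‖
  hessianLipschitz : ∀ x y, ‖hessian f x - hessian f y‖ ≤ L₂ * ‖x - y‖

/-- The uniform probability distribution on the unit sphere of `ℝ^d`: the normalized surface
measure. -/
noncomputable def uniformSphere (d : ℕ) :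
    Measure (Metric.sphere (0 : EuclideanSpace ℝ (Fin d)) 1) :=
  ((volume : Measure (EuclideanSpace ℝ (Fin d))).toSphere Set.univ)⁻¹ •
    (volume : Measure (EuclideanSpace ℝ (Fin d))).toSphere

/-- The points at which one step of the method evaluates the objective: the current point and its
two symmetric perturbations `x + σ s` and `x - σ s`. -/
def candidates {d : ℕ} (σ : ℝ) (x : EuclideanSpace ℝ (Fin d))
    (s : Metric.sphere (0 : EuclideanSpace ℝ (Fin d)) 1) : List (EuclideanSpace ℝ (Fin d)) :=
  [x, x + σ • (s : EuclideanSpace ℝ (Fin d)), x - σ • (s : EuclideanSpace ℝ (Fin d))]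

/-- The sampling radius of step `k`: gradient steps (`k` even) use `σ₁`, curvature steps (`k` odd)
use `σ₂`. -/
def radius (σ₁ σ₂ : ℝ) (k : ℕ) : ℝ := if Even k then σ₁ else σ₂

/-- A run of two-step random search, started from a random (possibly deterministic) point `x 0`.
In step `k` a direction `s k` is drawn uniformly from the unit sphere, independently of everything
that happened before (the history `ℱ k`), and `x (k + 1)` is a minimizer of `f` among the three
candidates; ties may be broken in any way that does not look into the future. -/
structure IsTwoStepRandomSearch {d : ℕ} {Ω : Type*} [mΩ : MeasurableSpace Ω] (P : Measure Ω)
    (f : EuclideanSpace ℝ (Fin d) → ℝ) (σ₁ σ₂ : ℝ) (ℱ : Filtration ℕ mΩ)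
    (s : ℕ → Ω → Metric.sphere (0 : EuclideanSpace ℝ (Fin d)) 1)
    (x : ℕ → Ω → EuclideanSpace ℝ (Fin d)) : Prop where
  adapted : ∀ k, Measurable[ℱ k] (x k)
  direction_measurable : ∀ k, Measurable[ℱ (k + 1)] (s k)
  direction_law : ∀ k, P.map (s k) = uniformSphere d
  direction_indep : ∀ k, Indep (MeasurableSpace.comap (s k) inferInstance) (ℱ k) P
  step_mem : ∀ k ω, x (k + 1) ω ∈ candidates (radius σ₁ σ₂ k) (x k ω) (s k ω)
  step_min : ∀ k ω, ∀ y ∈ candidates (radius σ₁ σ₂ k) (x k ω) (s k ω), f (x (k + 1) ω) ≤ f y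

/-- The number of function evaluations performed by the first `n` steps of a run, that is, up to the
computation of the iterate `x n`. -/
def evalCount {d : ℕ} {Ω : Type*} (σ₁ σ₂ : ℝ)
    (s : ℕ → Ω → Metric.sphere (0 : EuclideanSpace ℝ (Fin d)) 1)
    (x : ℕ → Ω → EuclideanSpace ℝ (Fin d)) (n : ℕ) (ω : Ω) : ℕ :=
  ∑ k ∈ Finset.range n, (candidates (radius σ₁ σ₂ k) (x k ω) (s k ω)).length

/-- The number of function evaluations performed until the first iterate that is an
`(ε, γ)`-second-order stationary point; it is `∞` if there is no such iterate. -/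
noncomputable def evalsToSOSP {d : ℕ} {Ω : Type*} (f : EuclideanSpace ℝ (Fin d) → ℝ)
    (ε γ σ₁ σ₂ : ℝ) (s : ℕ → Ω → Metric.sphere (0 : EuclideanSpace ℝ (Fin d)) 1)
    (x : ℕ → Ω → EuclideanSpace ℝ (Fin d)) (ω : Ω) : ℝ≥0∞ :=
  ⨅ (n : ℕ) (_ : IsSOSP f ε γ (x n ω)), (evalCount σ₁ σ₂ s x n ω : ℝ≥0∞)

end RandomSearch

namespace RandomSearch

variable {d : ℕ} {f : EuclideanSpace ℝ (Fin d) → ℝ} {L₁ L₂ : ℝ}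

/-! Write `γ = ε ^ (2 / 3)`. The method never increases `f`, so the expected decreases along a run,
conditional on each current point, sum to at most the initial gap (`tsum_expectedDecrease_le`). It
remains to show that non-stationary iterates force an expected decrease of at least `w =
guaranteedDecrease`; a first-hit argument then bounds `w * N`.

A large gradient, or a direction of negative curvature, yields a fixed decrease on a spherical cap
around one direction. A cap of radius `r` has probability at least `(r / 4) ^ d`, which is the
source of `κ ^ d`.

At a non-stationary even iterate, a large gradient makes the `σ₁` step pay. Under negative curvature
the `σ₂` step pays, but only after the `σ₁` step has moved the point. If `σ₁ ≤ σ₂`, that move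
changes the Hessian by at most `L₂ * σ₂ = γ / 2`, so half of the curvature survives. If `σ₂ ≤ σ₁`,
the radius `σ₂` is also short enough for the gradient argument, and the odd steps alone handle both
failures of stationarity. -/

/-- Two functions that agree at `0` compare on `[0, ∞)` as their derivatives do. -/
lemma le_of_hasDerivAt_le {u v u' v' : ℝ → ℝ} (hu : ∀ t, HasDerivAt u (u' t) t)
    (hv : ∀ t, HasDerivAt v (v' t) t) (h0 : u 0 = v 0) (h : ∀ t, 0 ≤ t → u' t ≤ v' t)
    {t : ℝ} (ht : 0 ≤ t) : u t ≤ v t := by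
  have hd : ∀ t, HasDerivAt (fun t => v t - u t) (v' t - u' t) t := fun t => (hv t).sub (hu t)
  have hmono : MonotoneOn (fun t => v t - u t) (Set.Ici 0) := by
    refine monotoneOn_of_deriv_nonneg (convex_Ici 0)
      (fun t _ => (hd t).continuousAt.continuousWithinAt)
      (fun t _ => (hd t).differentiableAt.differentiableWithinAt) fun t ht => ?_
    rw [interior_Ici] at ht
    rw [(hd t).deriv]
    linarith [h t (le_of_lt ht)]
  have := hmono Set.self_mem_Ici ht ht
  simp only [h0, sub_self] at this
  linarith

/-! ### Taylor bounds and negative curvature -/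

section Taylor

lemma SmoothnessAssumption.hasFDerivAt_gradient (hf : SmoothnessAssumption f L₁ L₂)
    (x : EuclideanSpace ℝ (Fin d)) : HasFDerivAt (gradient f) (hessian f x) x := by
  have h1 : ContDiff ℝ 1 (fderiv ℝ f) := hf.contDiff.fderiv_right (by norm_num)
  have h2 : ContDiff ℝ 1 (gradient f) :=
    (InnerProductSpace.toDual ℝ (EuclideanSpace ℝ (Fin d))).symm.contDiff.comp h1
  exact (h2.differentiable (by norm_num) x).hasFDerivAt

lemma SmoothnessAssumption.norm_hessian_le (hf : SmoothnessAssumption f L₁ L₂) (hL : 0 ≤ L₁)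
    (x : EuclideanSpace ℝ (Fin d)) : ‖hessian f x‖ ≤ L₁ :=
  norm_fderiv_le_of_lip' ℝ hL (Filter.Eventually.of_forall fun y => hf.smooth y x)

lemma SmoothnessAssumption.hasDerivAt_line (hf : SmoothnessAssumption f L₁ L₂)
    (x h : EuclideanSpace ℝ (Fin d)) (t : ℝ) :
    HasDerivAt (fun t : ℝ => f (x + t • h)) (inner ℝ (gradient f (x + t • h)) h) t := by
  have h1 : HasFDerivAt f (InnerProductSpace.toDual ℝ _ (gradient f (x + t • h))) (x + t • h) :=
    ((hf.contDiff.differentiable (by norm_num)) _).hasGradientAt.hasFDerivAt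
  have h2 : HasDerivAt (fun t : ℝ => x + t • h) h t := by
    simpa using ((hasDerivAt_id t).smul_const h).const_add x
  exact (h1.comp_hasDerivAt t h2).congr_deriv (by simp)

lemma SmoothnessAssumption.hasDerivAt_inner_gradient (hf : SmoothnessAssumption f L₁ L₂)
    (x h : EuclideanSpace ℝ (Fin d)) (t : ℝ) :
    HasDerivAt (fun t : ℝ => inner ℝ (gradient f (x + t • h)) h)
      (inner ℝ (hessian f (x + t • h) h) h) t := by
  have h2 : HasDerivAt (fun t : ℝ => x + t • h) h t := by
    simpa using ((hasDerivAt_id t).smul_const h).const_add x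
  have h3 := (hf.hasFDerivAt_gradient (x + t • h)).comp_hasDerivAt t h2
  simpa using h3.inner ℝ (hasDerivAt_const t h)

/-- The first-order Taylor bound of an `L₁`-smooth function. -/
lemma SmoothnessAssumption.add_le (hf : SmoothnessAssumption f L₁ L₂)
    (x h : EuclideanSpace ℝ (Fin d)) :
    f (x + h) ≤ f x + inner ℝ (gradient f x) h + L₁ / 2 * ‖h‖ ^ 2 := by
  have hv : ∀ t : ℝ, HasDerivAt
      (fun t : ℝ => f x + t * inner ℝ (gradient f x) h + t ^ 2 * (L₁ / 2 * ‖h‖ ^ 2))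
      (inner ℝ (gradient f x) h + t * (L₁ * ‖h‖ ^ 2)) t := fun t => by
    have h1 := (((hasDerivAt_id t).mul_const (inner ℝ (gradient f x) h)).const_add (f x)).add
      ((hasDerivAt_pow 2 t).mul_const (L₁ / 2 * ‖h‖ ^ 2))
    exact h1.congr_deriv (by norm_num; ring)
  have key := le_of_hasDerivAt_le (hf.hasDerivAt_line x h) hv (by simp) (fun t ht => ?_)
    (zero_le_one)
  · simpa using key
  · have h1 : inner ℝ (gradient f (x + t • h) - gradient f x) h ≤ L₁ * (t * ‖h‖) * ‖h‖ := by
      refine (real_inner_le_norm _ _).trans ?_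
      gcongr
      simpa [norm_smul, abs_of_nonneg ht] using hf.smooth (x + t • h) x
    rw [inner_sub_left] at h1
    nlinarith

lemma inner_apply_le (A : EuclideanSpace ℝ (Fin d) →L[ℝ] EuclideanSpace ℝ (Fin d))
    (v w : EuclideanSpace ℝ (Fin d)) : inner ℝ (A v) w ≤ ‖A‖ * ‖v‖ * ‖w‖ :=
  (real_inner_le_norm _ _).trans (by gcongr; exact A.le_opNorm v)

lemma SmoothnessAssumption.inner_hessian_le (hf : SmoothnessAssumption f L₁ L₂)
    (x y v : EuclideanSpace ℝ (Fin d)) :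
    inner ℝ (hessian f y v) v ≤ inner ℝ (hessian f x v) v + L₂ * ‖y - x‖ * ‖v‖ ^ 2 := by
  have h1 := inner_apply_le (hessian f y - hessian f x) v v
  rw [sub_apply, inner_sub_left] at h1
  have h2 : ‖hessian f y - hessian f x‖ * ‖v‖ * ‖v‖ ≤ L₂ * ‖y - x‖ * ‖v‖ ^ 2 := by
    rw [mul_assoc, ← sq]
    gcongr
    exact hf.hessianLipschitz y x
  linarith

/-- The second-order Taylor bound for symmetric differences of a function with `L₂`-Lipschitz
Hessian. -/
lemma SmoothnessAssumption.add_add_sub_le (hf : SmoothnessAssumption f L₁ L₂)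
    (x h : EuclideanSpace ℝ (Fin d)) :
    f (x + h) + f (x - h) ≤
      2 * f x + inner ℝ (hessian f x h) h + L₂ / 3 * ‖h‖ ^ 3 := by
  set a := inner ℝ (hessian f x h) h with ha
  -- The first derivative of `f (x + t • h) + f (x - t • h)` vanishes at `t = 0`, so the Hessian
  -- bound can be integrated twice from zero.
  have hψ : ∀ t : ℝ, HasDerivAt (fun t : ℝ => inner ℝ (gradient f (x + t • h)) h +
      inner ℝ (gradient f (x + t • (-h))) (-h))
      (inner ℝ (hessian f (x + t • h) h) h +
        inner ℝ (hessian f (x + t • (-h)) (-h)) (-h)) t := fun t =>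
    (hf.hasDerivAt_inner_gradient x h t).add (hf.hasDerivAt_inner_gradient x (-h) t)
  have hv1 : ∀ t : ℝ, HasDerivAt (fun t : ℝ => t * (2 * a) + t ^ 2 * (L₂ * ‖h‖ ^ 3))
      (2 * a + 2 * t * (L₂ * ‖h‖ ^ 3)) t := fun t => by
    have h1 := ((hasDerivAt_id t).mul_const (2 * a)).add
      ((hasDerivAt_pow 2 t).mul_const (L₂ * ‖h‖ ^ 3))
    exact h1.congr_deriv (by norm_num)
  have hv2 : ∀ t : ℝ, HasDerivAt
      (fun t : ℝ => 2 * f x + t ^ 2 * a + t ^ 3 * (L₂ / 3 * ‖h‖ ^ 3))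
      (t * (2 * a) + t ^ 2 * (L₂ * ‖h‖ ^ 3)) t := fun t => by
    have h1 := (((hasDerivAt_pow 2 t).mul_const a).const_add (2 * f x)).add
      ((hasDerivAt_pow 3 t).mul_const (L₂ / 3 * ‖h‖ ^ 3))
    exact h1.congr_deriv (by norm_num; ring)
  have h1 : ∀ t : ℝ, 0 ≤ t → inner ℝ (gradient f (x + t • h)) h +
      inner ℝ (gradient f (x + t • (-h))) (-h) ≤ t * (2 * a) + t ^ 2 * (L₂ * ‖h‖ ^ 3) :=
    fun t ht => le_of_hasDerivAt_le hψ hv1 (by simp) (fun t ht => by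
      have e1 := hf.inner_hessian_le x (x + t • h) h
      have e2 := hf.inner_hessian_le x (x + t • (-h)) h
      simp only [add_sub_cancel_left, norm_smul, norm_neg, Real.norm_eq_abs,
        abs_of_nonneg ht] at e1 e2
      simp only [map_neg, inner_neg_left, inner_neg_right, neg_neg]
      nlinarith) ht
  have h2 := le_of_hasDerivAt_le
    (fun t => (hf.hasDerivAt_line x h t).add (hf.hasDerivAt_line x (-h) t)) hv2
    (by simp; ring) h1 zero_le_one
  simpa [← sub_eq_add_neg] using h2

/-- If `lambdaMin A < -γ`, the quadratic form of `A` is at most `-γ` at some unit vector. -/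
lemma exists_inner_le_of_lambdaMin_lt
    {A : EuclideanSpace ℝ (Fin d) →L[ℝ] EuclideanSpace ℝ (Fin d)} {γ : ℝ} (hγ : 0 ≤ γ)
    (h : lambdaMin A < -γ) :
    ∃ v : EuclideanSpace ℝ (Fin d), ‖v‖ = 1 ∧ inner ℝ (A v) v ≤ -γ := by
  -- With no real eigenvalue the default `sInf ∅ = 0` would contradict `lambdaMin A < -γ ≤ 0`.
  obtain ⟨μ, hμ, hlt⟩ := exists_lt_of_csInf_lt (by
    by_contra hne
    rw [Set.not_nonempty_iff_eq_empty] at hne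
    rw [lambdaMin, hne, Real.sInf_empty] at h
    linarith) h
  obtain ⟨v, hv⟩ := hμ.exists_hasEigenvector
  have hv0 : ‖v‖ ≠ 0 := norm_ne_zero_iff.2 hv.2
  have hAv : A v = μ • v := hv.apply_eq_smul
  refine ⟨‖v‖⁻¹ • v, by simp [norm_smul, hv0], ?_⟩
  rw [map_smul, hAv, real_inner_smul_left, real_inner_smul_left, real_inner_smul_right,
    real_inner_self_eq_norm_sq]
  field_simp
  linarith

end Taylor

/-! ### Measure of spherical caps -/

section Sphere

open scoped Pointwise

/-- Spherical caps have exponentially large uniform measure at the worst. -/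
lemma le_uniformSphere_cap (hd : 1 ≤ d) {v : EuclideanSpace ℝ (Fin d)} (hv : ‖v‖ = 1) {r : ℝ}
    (hr : 0 < r) (hr1 : r ≤ 1) :
    ENNReal.ofReal ((r / 4) ^ d) ≤
      uniformSphere d {s | ‖(s : EuclideanSpace ℝ (Fin d)) - v‖ ≤ r} := by
  have : Nonempty (Fin d) := ⟨⟨0, hd⟩⟩
  set S : Set (Metric.sphere (0 : EuclideanSpace ℝ (Fin d)) 1) :=
    {s | ‖(s : EuclideanSpace ℝ (Fin d)) - v‖ ≤ r} with hS
  have hSm : MeasurableSet S :=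
    (isClosed_le (by fun_prop) continuous_const).measurableSet
  -- The cone over the cap contains a ball of radius `r / 4` about `v / 2`: there `‖y‖` is within `r
  -- / 4` of `1 / 2`, so normalizing `y` and doubling `y - v / 2` each contribute at most `r / 2`.
  -- Uniform measure is the volume ratio of cones.
  have hsub : Metric.ball ((1 / 2 : ℝ) • v) (r / 4) ⊆
      Set.Ioo (0 : ℝ) 1 • ((↑) '' S : Set (EuclideanSpace ℝ (Fin d))) := by
    intro y hy
    rw [Metric.mem_ball, dist_eq_norm] at hy
    have hhalf : ‖(1 / 2 : ℝ) • v‖ = 1 / 2 := by rw [norm_smul, hv]; norm_num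
    have ha := abs_norm_sub_norm_le y ((1 / 2 : ℝ) • v)
    rw [hhalf] at ha
    have ha' := abs_le.1 (ha.trans hy.le)
    have hy0 : 0 < ‖y‖ := by linarith [ha'.1]
    refine Set.mem_smul.2 ⟨‖y‖, ⟨hy0, by linarith [ha'.2]⟩, ‖y‖⁻¹ • y,
      ⟨⟨‖y‖⁻¹ • y, by simp [norm_smul, hy0.ne']⟩, ?_, rfl⟩, by
        rw [smul_smul, mul_inv_cancel₀ hy0.ne', one_smul]⟩
    change ‖‖y‖⁻¹ • y - v‖ ≤ r
    have e : ‖y‖⁻¹ • y - v = (‖y‖⁻¹ - 2) • y + (2 : ℝ) • (y - (1 / 2 : ℝ) • v) := by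
      module
    have e1 : ‖(‖y‖⁻¹ - 2) • y‖ ≤ r / 2 := by
      rw [norm_smul, Real.norm_eq_abs]
      nth_rewrite 2 [← abs_of_pos hy0]
      rw [← abs_mul, sub_mul, inv_mul_cancel₀ hy0.ne', abs_le]
      constructor <;> linarith [ha'.1, ha'.2]
    have e2 : ‖(2 : ℝ) • (y - (1 / 2 : ℝ) • v)‖ ≤ r / 2 := by
      rw [norm_smul, Real.norm_eq_abs, abs_two]
      linarith
    rw [e]
    exact (norm_add_le _ _).trans (by linarith)
  have hb0 : volume (Metric.ball (0 : EuclideanSpace ℝ (Fin d)) 1) ≠ 0 :=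
    (Metric.measure_ball_pos _ _ one_pos).ne'
  have hbt : volume (Metric.ball (0 : EuclideanSpace ℝ (Fin d)) 1) ≠ ∞ :=
    measure_ball_lt_top.ne
  have hdim : (Module.finrank ℝ (EuclideanSpace ℝ (Fin d)) : ℝ≥0∞) = d := by simp
  have hd0 : (d : ℝ≥0∞) ≠ 0 := by simpa using (Nat.one_le_iff_ne_zero.1 hd)
  have hball : volume (Metric.ball ((1 / 2 : ℝ) • v) (r / 4)) =
      ENNReal.ofReal ((r / 4) ^ d) * volume (Metric.ball (0 : EuclideanSpace ℝ (Fin d)) 1) := by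
    rw [Measure.addHaar_ball _ _ (by positivity)]
    simp
  rw [uniformSphere, Measure.smul_apply, smul_eq_mul, Measure.toSphere_apply' _ hSm,
    Measure.toSphere_apply_univ, hdim, ← ENNReal.div_eq_inv_mul,
    ENNReal.mul_div_mul_left _ _ hd0 (by simp),
    ENNReal.le_div_iff_mul_le (Or.inl hb0) (Or.inl hbt), ← hball]
  exact measure_mono hsub

end Sphere

/-! ### Expected decrease of a single step -/

/-- The decrease of the objective in one step of radius `σ` from `x` in direction `s`. -/
noncomputable def decrease (f : EuclideanSpace ℝ (Fin d) → ℝ) (σ : ℝ)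
    (x : EuclideanSpace ℝ (Fin d)) (s : Metric.sphere (0 : EuclideanSpace ℝ (Fin d)) 1) : ℝ≥0∞ :=
  ENNReal.ofReal (f x - min (f (x + σ • (s : EuclideanSpace ℝ (Fin d))))
    (f (x - σ • (s : EuclideanSpace ℝ (Fin d)))))

/-- The expected decrease of the objective in one step of radius `σ` from `x`. -/
noncomputable def expectedDecrease (f : EuclideanSpace ℝ (Fin d) → ℝ) (σ : ℝ)
    (x : EuclideanSpace ℝ (Fin d)) : ℝ≥0∞ :=
  ∫⁻ s, decrease f σ x s ∂uniformSphere d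

lemma measurable_decrease (hf : Continuous f) (σ : ℝ) :
    Measurable fun p : EuclideanSpace ℝ (Fin d) × Metric.sphere (0 : EuclideanSpace ℝ (Fin d)) 1 =>
      decrease f σ p.1 p.2 := by
  unfold decrease
  exact (ENNReal.continuous_ofReal.comp (by fun_prop)).measurable

instance : IsFiniteMeasure (uniformSphere d) := by
  unfold uniformSphere
  rcases eq_or_ne ((volume : Measure (EuclideanSpace ℝ (Fin d))).toSphere) 0 with h | h
  · rw [h, smul_zero]
    infer_instance
  · refine ⟨?_⟩
    rw [Measure.smul_apply, smul_eq_mul]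
    exact ENNReal.mul_lt_top (ENNReal.inv_lt_top.2 (Measure.measure_univ_pos.2 h))
      (measure_lt_top _ _)

lemma measurable_expectedDecrease (hf : Continuous f) (σ : ℝ) :
    Measurable (expectedDecrease f σ) :=
  (measurable_decrease hf σ).lintegral_prod_right'

/-- A decrease by `η` on a spherical cap of radius `r` gives an expected decrease. -/
lemma le_expectedDecrease_of_cap (hd : 1 ≤ d) (hf : Continuous f) {σ η r : ℝ}
    {x v : EuclideanSpace ℝ (Fin d)} (hv : ‖v‖ = 1) (hr : 0 < r) (hr1 : r ≤ 1)
    (h : ∀ s : EuclideanSpace ℝ (Fin d), ‖s‖ = 1 → ‖s - v‖ ≤ r →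
      min (f (x + σ • s)) (f (x - σ • s)) ≤ f x - η) :
    ENNReal.ofReal ((r / 4) ^ d * η) ≤ expectedDecrease f σ x := by
  rw [ENNReal.ofReal_mul (by positivity), mul_comm]
  have hm : Measurable (decrease f σ x) :=
    (measurable_decrease hf σ).comp measurable_prodMk_left
  refine le_trans ?_ (mul_meas_ge_le_lintegral hm (ENNReal.ofReal η))
  gcongr
  refine (le_uniformSphere_cap hd hv hr hr1).trans (measure_mono fun s hs => ?_)
  exact ENNReal.ofReal_le_ofReal (by linarith [h s (by simp) hs])

/-- On the cap of radius `1 / 2` about the negative gradient direction the slope is at most `-ε /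
2`; the quadratic Taylor term gives back at most `σ * ε / 4`. -/
lemma le_expectedDecrease_of_gradient (hd : 1 ≤ d) (hf : SmoothnessAssumption f L₁ L₂)
    {σ ε : ℝ} (hε : 0 < ε) (hσ : 0 ≤ σ) (hσε : L₁ * σ ≤ ε / 2)
    {x : EuclideanSpace ℝ (Fin d)} (hx : ε < ‖gradient f x‖) :
    ENNReal.ofReal ((1 / 8) ^ d * (σ * ε / 4)) ≤ expectedDecrease f σ x := by
  set g := gradient f x with hg
  have hg0 : 0 < ‖g‖ := hε.trans hx
  have key := le_expectedDecrease_of_cap (σ := σ) (η := σ * ε / 4) (r := 1 / 2)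
    (v := -(‖g‖⁻¹ • g)) (x := x) hd hf.contDiff.continuous
    (by rw [norm_neg, norm_smul, norm_inv, norm_norm, inv_mul_cancel₀ hg0.ne']) (by norm_num)
    (by norm_num) fun s hs hsv => by
      refine (min_le_left _ _).trans ?_
      have h1 := hf.add_le x (σ • s)
      rw [← hg, real_inner_smul_right, norm_smul, hs, mul_one, Real.norm_eq_abs, sq_abs] at h1
      have h2 : inner ℝ g s ≤ -(ε / 2) := by
        have e : inner ℝ g s = inner ℝ g (-(‖g‖⁻¹ • g)) + inner ℝ g (s - -(‖g‖⁻¹ • g)) := by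
          rw [← inner_add_right, add_sub_cancel]
        have e1 : inner ℝ g (-(‖g‖⁻¹ • g)) = -‖g‖ := by
          rw [inner_neg_right, real_inner_smul_right, real_inner_self_eq_norm_sq]
          field_simp
        have e2 := (real_inner_le_norm g (s - -(‖g‖⁻¹ • g))).trans
          (mul_le_mul_of_nonneg_left hsv hg0.le)
        linarith
      nlinarith [mul_le_mul_of_nonneg_left h2 hσ, mul_le_mul_of_nonneg_left hσε hσ]
  convert key using 4
  norm_num

/-- Only curvature `γ / 2` is required, since a gradient step may have spent the other half. In
units of `σ ^ 2 * γ`, the symmetric sum gains `1 / 2`, loses `1 / 12` by replacing `v` with `s` and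
`1 / 6` to the cubic term; the better of the two points gets half of the remaining `1 / 4`. -/
lemma le_expectedDecrease_of_curvature (hd : 1 ≤ d) (hf : SmoothnessAssumption f L₁ L₂)
    {σ γ : ℝ} (hL₁ : 0 < L₁) (hγ : 0 < γ) (hγL : γ ≤ L₁) (hσ : 0 ≤ σ) (hσγ : L₂ * σ = γ / 2)
    {x v : EuclideanSpace ℝ (Fin d)} (hv : ‖v‖ = 1) (hx : inner ℝ (hessian f x v) v ≤ -(γ / 2)) :
    ENNReal.ofReal ((γ / (96 * L₁)) ^ d * (σ ^ 2 * γ / 8)) ≤ expectedDecrease f σ x := by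
  have hr : 0 < γ / (24 * L₁) := by positivity
  have key := le_expectedDecrease_of_cap (σ := σ) (η := σ ^ 2 * γ / 8) (r := γ / (24 * L₁))
    (v := v) (x := x) hd hf.contDiff.continuous hv hr
    (by rw [div_le_one (by positivity)]; linarith) fun s hs hsv => by
      have h1 := hf.add_add_sub_le x (σ • s)
      rw [map_smul, real_inner_smul_right, real_inner_smul_left, norm_smul, hs, mul_one,
        Real.norm_eq_abs, abs_of_nonneg hσ] at h1
      have hH := hf.norm_hessian_le hL₁.le x
      have hb : ‖hessian f x‖ * ‖s - v‖ ≤ γ / 24 :=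
        (mul_le_mul hH hsv (norm_nonneg _) hL₁.le).trans_eq (by field_simp)
      have h2 : inner ℝ (hessian f x s) s ≤ -(5 * γ / 12) := by
        have e : inner ℝ (hessian f x s) s = inner ℝ (hessian f x v) v +
            inner ℝ (hessian f x (s - v)) s + inner ℝ (hessian f x v) (s - v) := by
          rw [map_sub, inner_sub_left, inner_sub_right]
          ring
        have e1 := inner_apply_le (hessian f x) (s - v) s
        have e2 := inner_apply_le (hessian f x) v (s - v)
        rw [hs, mul_one] at e1
        rw [hv, mul_one] at e2
        linarith
      have h3 : L₂ / 3 * σ ^ 3 = σ ^ 2 * (γ / 6) := by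
        linear_combination σ ^ 2 / 3 * hσγ
      have h4 : f (x + σ • s) + f (x - σ • s) ≤ 2 * f x - σ ^ 2 * γ / 4 := by
        nlinarith [mul_le_mul_of_nonneg_left h2 (sq_nonneg σ)]
      rcases le_total (f (x + σ • s)) (f (x - σ • s)) with h | h
      · exact (min_le_left _ _).trans (by linarith)
      · exact (min_le_right _ _).trans (by linarith)
  convert key using 4
  field_simp
  norm_num

/-! ### Telescoping along a run -/

section Run

variable {Ω : Type*} [mΩ : MeasurableSpace Ω] {P : Measure Ω}
  {σ₁ σ₂ : ℝ} {ℱ : Filtration ℕ mΩ} {s : ℕ → Ω → Metric.sphere (0 : EuclideanSpace ℝ (Fin d)) 1}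
  {x : ℕ → Ω → EuclideanSpace ℝ (Fin d)}

lemma IsTwoStepRandomSearch.measurable (h : IsTwoStepRandomSearch P f σ₁ σ₂ ℱ s x) (k : ℕ) :
    Measurable (x k) :=
  (h.adapted k).mono (ℱ.le k) le_rfl

lemma IsTwoStepRandomSearch.isProbabilityMeasure [IsProbabilityMeasure P]
     (h : IsTwoStepRandomSearch P f σ₁ σ₂ ℱ s x) : IsProbabilityMeasure (uniformSphere d) := by
  rw [← h.direction_law 0]
  exact Measure.isProbabilityMeasure_map
    ((h.direction_measurable 0).mono (ℱ.le _) le_rfl).aemeasurable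

lemma IsTwoStepRandomSearch.lintegral_decrease [IsProbabilityMeasure P]
    (h : IsTwoStepRandomSearch P f σ₁ σ₂ ℱ s x)
    (hf : Continuous f) (σ : ℝ) (k : ℕ) :
    ∫⁻ ω, decrease f σ (x k ω) (s k ω) ∂P = ∫⁻ ω, expectedDecrease f σ (x k ω) ∂P := by
  have hs : Measurable (s k) := (h.direction_measurable k).mono (ℱ.le _) le_rfl
  have hx := h.measurable k
  have hind : IndepFun (x k) (s k) P := by
    rw [IndepFun_iff_Indep]
    exact (indep_of_indep_of_le_right (h.direction_indep k) (h.adapted k).comap_le).symm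
  have hmap := hind.map_prod_eq_prod_map_map hx.aemeasurable hs.aemeasurable
  rw [h.direction_law k] at hmap
  have h1 := lintegral_map (μ := P) (measurable_decrease hf σ) (hx.prodMk hs)
  rw [← h1, hmap, lintegral_prod _ (measurable_decrease hf σ).aemeasurable,
    lintegral_map (measurable_decrease hf σ).lintegral_prod_right' hx]
  rfl

lemma IsTwoStepRandomSearch.gap_succ_add_decrease_le
    (h : IsTwoStepRandomSearch P f σ₁ σ₂ ℱ s x) (hb : BddBelow (Set.range f)) (k : ℕ) (ω : Ω) :
    ENNReal.ofReal (f (x (k + 1) ω) - ⨅ y, f y) +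
      decrease f (radius σ₁ σ₂ k) (x k ω) (s k ω) ≤ ENNReal.ofReal (f (x k ω) - ⨅ y, f y) := by
  have hmin := h.step_min k ω
  simp only [candidates, List.mem_cons, List.not_mem_nil, or_false, forall_eq_or_imp,
    forall_eq] at hmin
  obtain ⟨h0, h1, h2⟩ := hmin
  have hinf := ciInf_le hb (x (k + 1) ω)
  rw [decrease]
  set m := min (f (x k ω + radius σ₁ σ₂ k • (s k ω : EuclideanSpace ℝ (Fin d))))
    (f (x k ω - radius σ₁ σ₂ k • (s k ω : EuclideanSpace ℝ (Fin d))))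
  have hm : f (x (k + 1) ω) ≤ m := le_min h1 h2
  -- If neither perturbation improves, `decrease` truncates to zero, matching the option of staying
  -- put.
  rcases le_total (f (x k ω) - m) 0 with hn | hn
  · rw [ENNReal.ofReal_of_nonpos hn, add_zero]
    exact ENNReal.ofReal_le_ofReal (by linarith)
  · rw [← ENNReal.ofReal_add (by linarith) hn]
    exact ENNReal.ofReal_le_ofReal (by linarith)

lemma expectedDecrease_le [IsProbabilityMeasure (uniformSphere d)] (hb : BddBelow (Set.range f))
    (σ : ℝ) (x : EuclideanSpace ℝ (Fin d)) :
    expectedDecrease f σ x ≤ ENNReal.ofReal (f x - ⨅ y, f y) := by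
  calc expectedDecrease f σ x
      ≤ ∫⁻ _, ENNReal.ofReal (f x - ⨅ y, f y) ∂uniformSphere d :=
        lintegral_mono fun s => ENNReal.ofReal_le_ofReal
          (sub_le_sub_left (le_min (ciInf_le hb _) (ciInf_le hb _)) _)
    _ = _ := by simp

/-- The expected decreases along a run sum up to at most the initial optimality gap. -/
lemma IsTwoStepRandomSearch.tsum_expectedDecrease_le [IsProbabilityMeasure P]
     (h : IsTwoStepRandomSearch P f σ₁ σ₂ ℱ s x) (hf : Continuous f)
    (hb : BddBelow (Set.range f)) :
    ∫⁻ ω, ∑' k, expectedDecrease f (radius σ₁ σ₂ k) (x k ω) ∂P ≤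
      ∫⁻ ω, ENNReal.ofReal (f (x 0 ω) - ⨅ y, f y) ∂P := by
  have hm : ∀ k, Measurable fun ω => expectedDecrease f (radius σ₁ σ₂ k) (x k ω) := fun k =>
    (measurable_expectedDecrease hf _).comp (h.measurable k)
  rw [lintegral_tsum fun k => (hm k).aemeasurable]
  refine ENNReal.tsum_le_of_sum_range_le fun n => ?_
  -- Keeping the remaining gap on the left makes the sum telescope without subtraction in `ℝ≥0∞`.
  suffices H : ∫⁻ ω, ENNReal.ofReal (f (x n ω) - ⨅ y, f y) ∂P +
      ∑ k ∈ Finset.range n, ∫⁻ ω, expectedDecrease f (radius σ₁ σ₂ k) (x k ω) ∂P ≤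
      ∫⁻ ω, ENNReal.ofReal (f (x 0 ω) - ⨅ y, f y) ∂P from le_trans le_add_self H
  induction n with
  | zero => simp
  | succ n ih =>
    refine le_trans ?_ ih
    rw [Finset.sum_range_succ, add_comm (Finset.sum _ _), ← add_assoc]
    gcongr
    rw [← h.lintegral_decrease hf, ← lintegral_add_left]
    · exact lintegral_mono fun ω => h.gap_succ_add_decrease_le hb n ω
    · exact ((hf.measurable.comp (h.measurable _)).sub_const _).ennreal_ofReal

end Run

/-! ### From decreases to the hitting time -/

section Hitting

/-- If every index before the first hit contributes at least `w`, the total bounds the first hit. -/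
lemma exists_mul_le_tsum_or_tsum_eq_top {T : ℕ → Prop} {b : ℕ → ℝ≥0∞} {w : ℝ≥0∞} (hw : w ≠ 0)
    (h : ∀ j, ¬ T j → w ≤ b j) :
    (∃ j, T j ∧ w * j ≤ ∑' i, b i) ∨ ∑' i, b i = ∞ := by
  classical
  by_cases hT : ∃ j, T j
  · refine Or.inl ⟨Nat.find hT, Nat.find_spec hT, ?_⟩
    calc w * (Nat.find hT : ℝ≥0∞) = ∑ _i ∈ Finset.range (Nat.find hT), w := by
          rw [Finset.sum_const, Finset.card_range, nsmul_eq_mul, mul_comm]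
      _ ≤ ∑ i ∈ Finset.range (Nat.find hT), b i :=
          Finset.sum_le_sum fun i hi => h i (Nat.find_min hT (Finset.mem_range.1 hi))
      _ ≤ _ := ENNReal.sum_le_tsum _
  · push Not at hT
    refine Or.inr (top_le_iff.1 ?_)
    rw [← ENNReal.tsum_const_eq_top_of_ne_zero (α := ℕ) hw]
    exact ENNReal.tsum_le_tsum fun j => h j (hT j)

variable {Ω : Type*} {σ₁ σ₂ ε γ : ℝ}
  {s : ℕ → Ω → Metric.sphere (0 : EuclideanSpace ℝ (Fin d)) 1}
  {x : ℕ → Ω → EuclideanSpace ℝ (Fin d)} {ω : Ω}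

lemma evalsToSOSP_le {n : ℕ} (h : IsSOSP f ε γ (x n ω)) :
    evalsToSOSP f ε γ σ₁ σ₂ s x ω ≤ 3 * n := by
  refine (iInf₂_le n h).trans_eq ?_
  simp [evalCount, candidates, mul_comm]

/-- Each pair of steps costs six evaluations, and the first even hit bounds the first hit. -/
lemma mul_evalsToSOSP_le_of_pair {w : ℝ≥0∞} (hw : w ≠ 0) {D : ℕ → ℝ≥0∞}
    (h : ∀ j, ¬ IsSOSP f ε γ (x (2 * j) ω) → w ≤ D (2 * j) + D (2 * j + 1)) :
    w * evalsToSOSP f ε γ σ₁ σ₂ s x ω ≤ 6 * ∑' k, D k := by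
  have hsum : ∑' j, (D (2 * j) + D (2 * j + 1)) = ∑' k, D k := by
    rw [ENNReal.tsum_add, tsum_even_add_odd ENNReal.summable ENNReal.summable]
  rcases exists_mul_le_tsum_or_tsum_eq_top hw h with ⟨j, hj, hle⟩ | htop
  · calc w * evalsToSOSP f ε γ σ₁ σ₂ s x ω ≤ w * (3 * (2 * j : ℕ)) := by
          gcongr
          exact evalsToSOSP_le hj
      _ = 6 * (w * j) := by push_cast; ring
      _ ≤ _ := by rw [← hsum]; gcongr
  · rw [← hsum, htop, ENNReal.mul_top (by norm_num)]
    exact le_top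

/-- Reaching the first odd iterate costs three evaluations that no odd step pays for; `D₀` covers
them. -/
lemma mul_evalsToSOSP_le_of_odd {w : ℝ≥0∞} (hw : w ≠ 0) {D : ℕ → ℝ≥0∞} {D₀ : ℝ≥0∞}
    (h₀ : ¬ IsSOSP f ε γ (x 0 ω) → w ≤ D₀)
    (h : ∀ j, ¬ IsSOSP f ε γ (x (2 * j + 1) ω) → w ≤ D (2 * j + 1)) :
    w * evalsToSOSP f ε γ σ₁ σ₂ s x ω ≤ 6 * ∑' k, D k + 3 * D₀ := by
  by_cases hx : IsSOSP f ε γ (x 0 ω)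
  · have := evalsToSOSP_le (σ₁ := σ₁) (σ₂ := σ₂) (s := s) hx
    simp only [Nat.cast_zero, mul_zero, nonpos_iff_eq_zero] at this
    simp [this]
  have hsum : ∑' j, D (2 * j + 1) ≤ ∑' k, D k := by
    rw [← tsum_even_add_odd (f := D) ENNReal.summable ENNReal.summable]
    exact le_add_self
  rcases exists_mul_le_tsum_or_tsum_eq_top hw h with ⟨j, hj, hle⟩ | htop
  · calc w * evalsToSOSP f ε γ σ₁ σ₂ s x ω ≤ w * (3 * (2 * j + 1 : ℕ)) := by
          gcongr
          exact evalsToSOSP_le hj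
      _ = 6 * (w * j) + 3 * w := by push_cast; ring
      _ ≤ _ := by
        gcongr
        · exact hle.trans hsum
        · exact h₀ hx
  · rw [top_le_iff.1 (htop.symm.trans_le hsum), ENNReal.mul_top (by norm_num), top_add]
    exact le_top

end Hitting

/-! ### Comparison of constants -/

/-- A guaranteed lower bound on the expected decrease, with `γ` in the role of `ε ^ (2 / 3)`. -/
noncomputable def guaranteedDecrease (d : ℕ) (L₁ L₂ ε γ : ℝ) : ℝ :=
  ε ^ 2 / (32 * (min L₁ γ + L₂ ^ 2) * (96 * max 1 (L₁ / γ)) ^ d)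

section Constants

variable {ε γ : ℝ}

lemma guaranteedDecrease_pos (hL₁ : 0 < L₁) (hε : 0 < ε) (hγ : 0 < γ) :
    0 < guaranteedDecrease d L₁ L₂ ε γ := by
  have : 0 < min L₁ γ := lt_min hL₁ hγ
  unfold guaranteedDecrease
  positivity

lemma two_le_sqrt_two_pi_mul (hd : 1 ≤ d) : 2 ≤ √(2 * Real.pi * d) := by
  have hd' : (1 : ℝ) ≤ d := by exact_mod_cast hd
  refine Real.le_sqrt_of_sq_le ?_
  nlinarith [Real.pi_gt_three]

lemma sqrt_two_pi_mul_le (d : ℕ) : √(2 * Real.pi * d) ≤ 3 * 2 ^ d := by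
  have hd : (d : ℝ) ≤ 4 ^ d := by
    exact_mod_cast (Nat.lt_pow_self (by norm_num : 1 < 4)).le
  refine Real.sqrt_le_iff.2 ⟨by positivity, ?_⟩
  rw [mul_pow, ← pow_mul, mul_comm d 2, pow_mul]
  norm_num
  nlinarith [Real.pi_lt_d2, Real.pi_pos, (Nat.cast_nonneg d : (0 : ℝ) ≤ d)]

/-- One of the `d ≥ 1` factors of `κ` absorbs the excess of `L₁` over `γ`, leaving `min L₁ γ` in the
prefactor. -/
lemma le_min_mul_max_pow (hd : 1 ≤ d) (hL₁ : 0 < L₁) (hγ : 0 < γ) :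
    L₁ ≤ min L₁ γ * max 1 (L₁ / γ) ^ d := by
  have h1 : max 1 (L₁ / γ) ≤ max 1 (L₁ / γ) ^ d :=
    le_self_pow₀ (le_max_left _ _) (Nat.one_le_iff_ne_zero.1 hd)
  have h0 : 0 < min L₁ γ := lt_min hL₁ hγ
  refine le_trans ?_ (mul_le_mul_of_nonneg_left h1 h0.le)
  rcases le_total L₁ γ with h | h
  · rw [min_eq_left h]
    exact le_mul_of_one_le_right hL₁.le (le_max_left _ _)
  · rw [min_eq_right h]
    calc L₁ = γ * (L₁ / γ) := by field_simp
      _ ≤ _ := by gcongr; exact le_max_right _ _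

lemma guaranteedDecrease_le_gradientStep (hd : 1 ≤ d) (hL₁ : 0 < L₁) (hγ : 0 < γ) :
    guaranteedDecrease d L₁ L₂ ε γ ≤
      (1 / 8) ^ d * (ε / (L₁ * √(2 * Real.pi * d)) * ε / 4) := by
  have hq := two_le_sqrt_two_pi_mul hd
  have hq' := sqrt_two_pi_mul_le d
  set q := √(2 * Real.pi * d)
  have hq0 : 0 < q := by linarith
  have e : (1 / 8 : ℝ) ^ d * (ε / (L₁ * q) * ε / 4) = ε ^ 2 / (4 * L₁ * q * 8 ^ d) := by
    rw [one_div, inv_pow]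
    field_simp
  rw [e, guaranteedDecrease]
  refine div_le_div_of_nonneg_left (by positivity) (by positivity) ?_
  have hm := le_min_mul_max_pow (d := d) hd hL₁ hγ
  set M := max 1 (L₁ / γ)
  have hM : 1 ≤ M := le_max_left _ _
  calc 4 * L₁ * q * 8 ^ d ≤ 4 * (min L₁ γ * M ^ d) * (3 * 2 ^ d) * 8 ^ d := by gcongr
    _ = 12 * min L₁ γ * (16 * M) ^ d := by
        rw [mul_pow, show (16 : ℝ) = 2 * 8 by norm_num, mul_pow]
        ring
    _ ≤ 32 * (min L₁ γ + L₂ ^ 2) * (96 * M) ^ d := by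
        have : 0 < min L₁ γ := lt_min hL₁ hγ
        gcongr
        · norm_num
        · exact le_add_of_nonneg_right (sq_nonneg L₂)
        · norm_num

lemma guaranteedDecrease_le_curvatureStep (hL₁ : 0 < L₁) (hL₂ : 0 < L₂) (hγ : 0 < γ)
    (hγL : γ ≤ L₁) (hγε : γ ^ 3 = ε ^ 2) :
    guaranteedDecrease d L₁ L₂ ε γ ≤
      (γ / (96 * L₁)) ^ d * ((γ / (2 * L₂)) ^ 2 * γ / 8) := by
  have e : (γ / (96 * L₁)) ^ d * ((γ / (2 * L₂)) ^ 2 * γ / 8) =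
      ε ^ 2 / (32 * L₂ ^ 2 * (96 * (L₁ / γ)) ^ d) := by
    rw [show (γ / (96 * L₁)) = (96 * (L₁ / γ))⁻¹ by field_simp, inv_pow, ← hγε]
    field_simp
    norm_num
  rw [e, guaranteedDecrease, max_eq_right ((one_le_div hγ).2 hγL)]
  have : 0 < min L₁ γ := lt_min hL₁ hγ
  gcongr
  linarith

lemma guaranteedDecrease_le_curvatureStep_of_gradient (hL₂ : 0 < L₂)
    (hε : 0 < ε) (hγ : 0 < γ) (hγL : γ ≤ L₁) (hγε : γ ^ 3 = ε ^ 2) :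
    guaranteedDecrease d L₁ L₂ ε γ ≤ (1 / 8) ^ d * (γ / (2 * L₂) * ε / 4) := by
  -- Squared and divided by `γ ^ 2`, using `γ ^ 3 = ε ^ 2`, this is `L₂ ^ 2 * γ ≤ (γ + L₂ ^ 2) ^ 2`.
  have hamgm : L₂ * ε ≤ (γ + L₂ ^ 2) * γ := by
    refine le_of_sq_le_sq ?_ (by positivity)
    rw [mul_pow, ← hγε, mul_pow]
    nlinarith [mul_nonneg (sq_nonneg γ) (sq_nonneg (γ - L₂ ^ 2)),
      mul_pos (pow_pos hγ 3) (pow_pos hL₂ 2)]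
  rw [guaranteedDecrease, min_eq_right hγL]
  have hM : (8 : ℝ) ^ d ≤ (96 * max 1 (L₁ / γ)) ^ d := by
    gcongr
    linarith [le_max_left 1 (L₁ / γ)]
  calc ε ^ 2 / (32 * (γ + L₂ ^ 2) * (96 * max 1 (L₁ / γ)) ^ d)
      ≤ ε ^ 2 / (32 * (γ + L₂ ^ 2) * 8 ^ d) := by gcongr
    _ = (1 / 8) ^ d * (ε ^ 2 / (32 * (γ + L₂ ^ 2))) := by
        rw [one_div, inv_pow]
        field_simp
    _ ≤ (1 / 8) ^ d * (γ / (2 * L₂) * ε / 4) := by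
        refine mul_le_mul_of_nonneg_left ?_ (by positivity)
        rw [div_mul_eq_mul_div, div_div, div_le_div_iff₀ (by positivity) (by positivity)]
        nlinarith [mul_le_mul_of_nonneg_left hamgm hε.le, mul_pos hε (mul_pos hγ hγ),
          mul_pos hε (mul_pos hγ (pow_pos hL₂ 2))]

end Constants

/-! ### Assembling the bound -/

section Main

variable {Ω : Type*} [mΩ : MeasurableSpace Ω] {P : Measure Ω} {σ₁ σ₂ ε γ : ℝ}
  {ℱ : Filtration ℕ mΩ} {s : ℕ → Ω → Metric.sphere (0 : EuclideanSpace ℝ (Fin d)) 1}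
  {x : ℕ → Ω → EuclideanSpace ℝ (Fin d)}

lemma lt_norm_gradient_or_curvature_of_not_isSOSP (hγ : 0 < γ) {y : EuclideanSpace ℝ (Fin d)}
    (h : ¬ IsSOSP f ε γ y) :
    ε < ‖gradient f y‖ ∨
      ∃ v : EuclideanSpace ℝ (Fin d), ‖v‖ = 1 ∧ inner ℝ (hessian f y v) v ≤ -γ := by
  rw [IsSOSP, not_and_or, not_le, not_le] at h
  exact h.imp_right (exists_inner_le_of_lambdaMin_lt hγ.le)

/-- Hence for `γ > L₁` only the gradient condition can fail. -/
lemma SmoothnessAssumption.le_of_curvature (hf : SmoothnessAssumption f L₁ L₂) (hL₁ : 0 ≤ L₁)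
    {y v : EuclideanSpace ℝ (Fin d)} (hv : ‖v‖ = 1) (h : inner ℝ (hessian f y v) v ≤ -γ) :
    γ ≤ L₁ := by
  have h1 := inner_apply_le (-hessian f y) v v
  rw [neg_apply, inner_neg_left, norm_neg, hv] at h1
  linarith [hf.norm_hessian_le hL₁ y]

lemma IsTwoStepRandomSearch.norm_succ_sub_le (h : IsTwoStepRandomSearch P f σ₁ σ₂ ℱ s x)
    (k : ℕ) (ω : Ω) : ‖x (k + 1) ω - x k ω‖ ≤ |radius σ₁ σ₂ k| := by
  have := h.step_mem k ω
  simp only [candidates, List.mem_cons, List.not_mem_nil, or_false] at this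
  rcases this with h | h | h <;> rw [h] <;> simp [norm_smul]

lemma IsTwoStepRandomSearch.mul_evalsToSOSP_le (h : IsTwoStepRandomSearch P f σ₁ σ₂ ℱ s x)
    (hd : 1 ≤ d) (hL₁ : 0 < L₁) (hL₂ : 0 < L₂) (hε : 0 < ε) (hγ : 0 < γ) (hγε : γ ^ 3 = ε ^ 2)
    (hf : SmoothnessAssumption f L₁ L₂) (hσ₁ : σ₁ = ε / (L₁ * √(2 * Real.pi * d)))
    (hσ₂ : σ₂ = γ / (2 * L₂)) (ω : Ω) :
    ENNReal.ofReal (guaranteedDecrease d L₁ L₂ ε γ) * evalsToSOSP f ε γ σ₁ σ₂ s x ω ≤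
      6 * ∑' k, expectedDecrease f (radius σ₁ σ₂ k) (x k ω) +
        3 * expectedDecrease f σ₂ (x 0 ω) := by
  have hw := (ENNReal.ofReal_pos.2
    (guaranteedDecrease_pos (d := d) (L₁ := L₁) (L₂ := L₂) hL₁ hε hγ)).ne'
  have hq := two_le_sqrt_two_pi_mul hd
  have hσ₁0 : 0 < σ₁ := by rw [hσ₁]; positivity
  have hσ₂0 : 0 < σ₂ := by rw [hσ₂]; positivity
  have hLσ₁ : L₁ * σ₁ ≤ ε / 2 := by
    rw [hσ₁, ← mul_div_assoc, mul_div_mul_left _ _ hL₁.ne']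
    gcongr
  have hLσ₂ : L₂ * σ₂ = γ / 2 := by rw [hσ₂]; field_simp
  have even_step : ∀ j, radius σ₁ σ₂ (2 * j) = σ₁ := fun j => by simp [radius]
  have odd_step : ∀ j, radius σ₁ σ₂ (2 * j + 1) = σ₂ := fun j => by simp [radius]
  have gradient_step : ∀ y, ε < ‖gradient f y‖ →
      ENNReal.ofReal (guaranteedDecrease d L₁ L₂ ε γ) ≤ expectedDecrease f σ₁ y := fun y hy =>
    (ENNReal.ofReal_le_ofReal
      ((guaranteedDecrease_le_gradientStep hd hL₁ hγ).trans_eq (by rw [hσ₁]))).trans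
      (le_expectedDecrease_of_gradient hd hf hε hσ₁0.le hLσ₁ hy)
  have curvature_step : γ ≤ L₁ → ∀ y v : EuclideanSpace ℝ (Fin d), ‖v‖ = 1 →
      inner ℝ (hessian f y v) v ≤ -(γ / 2) →
      ENNReal.ofReal (guaranteedDecrease d L₁ L₂ ε γ) ≤ expectedDecrease f σ₂ y :=
    fun hγL y v hv hy => (ENNReal.ofReal_le_ofReal
      ((guaranteedDecrease_le_curvatureStep hL₁ hL₂ hγ hγL hγε).trans_eq (by rw [hσ₂]))).trans
      (le_expectedDecrease_of_curvature hd hf hL₁ hγ hγL hσ₂0.le hLσ₂ hv hy)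
  by_cases hcase : γ ≤ L₁ ∧ σ₂ ≤ σ₁
  · obtain ⟨hγL, hσ⟩ := hcase
    have step : ∀ y, ¬ IsSOSP f ε γ y →
        ENNReal.ofReal (guaranteedDecrease d L₁ L₂ ε γ) ≤ expectedDecrease f σ₂ y := by
      intro y hy
      rcases lt_norm_gradient_or_curvature_of_not_isSOSP hγ hy with hy | ⟨v, hv, hy⟩
      · exact (ENNReal.ofReal_le_ofReal
          ((guaranteedDecrease_le_curvatureStep_of_gradient hL₂ hε hγ hγL hγε).trans_eq
            (by rw [hσ₂]))).trans (le_expectedDecrease_of_gradient hd hf hε hσ₂0.le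
              ((mul_le_mul_of_nonneg_left hσ hL₁.le).trans hLσ₁) hy)
      · exact curvature_step hγL y v hv (by linarith)
    refine mul_evalsToSOSP_le_of_odd hw (step _) fun j hj => ?_
    rw [odd_step]
    exact step _ hj
  · refine le_add_right (mul_evalsToSOSP_le_of_pair hw fun j hj => ?_)
    rw [odd_step, even_step]
    rcases lt_norm_gradient_or_curvature_of_not_isSOSP hγ hj with hy | ⟨v, hv, hy⟩
    · exact le_add_right (gradient_step _ hy)
    · have hγL := hf.le_of_curvature hL₁.le hv hy
      have hσ : σ₁ ≤ σ₂ := by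
        by_contra hσ
        exact hcase ⟨hγL, (not_le.1 hσ).le⟩
      refine le_add_left (curvature_step hγL _ v hv ?_)
      have hmove := h.norm_succ_sub_le (2 * j) ω
      rw [even_step, abs_of_pos hσ₁0] at hmove
      have h1 := hf.inner_hessian_le (x (2 * j) ω) (x (2 * j + 1) ω) v
      rw [hv] at h1
      nlinarith [mul_le_mul_of_nonneg_left (hmove.trans hσ) hL₂.le]

lemma IsTwoStepRandomSearch.mul_lintegral_evalsToSOSP_le [IsProbabilityMeasure P]
    (h : IsTwoStepRandomSearch P f σ₁ σ₂ ℱ s x)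
    (hd : 1 ≤ d) (hL₁ : 0 < L₁) (hL₂ : 0 < L₂) (hε : 0 < ε) (hγ : 0 < γ) (hγε : γ ^ 3 = ε ^ 2)
    (hf : SmoothnessAssumption f L₁ L₂) (hσ₁ : σ₁ = ε / (L₁ * √(2 * Real.pi * d)))
    (hσ₂ : σ₂ = γ / (2 * L₂)) :
    ENNReal.ofReal (guaranteedDecrease d L₁ L₂ ε γ) *
        ∫⁻ ω, evalsToSOSP f ε γ σ₁ σ₂ s x ω ∂P ≤
      9 * ∫⁻ ω, ENNReal.ofReal (f (x 0 ω) - ⨅ y, f y) ∂P := by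
  have := h.isProbabilityMeasure
  have hc := hf.contDiff.continuous
  have hm : Measurable fun ω => expectedDecrease f σ₂ (x 0 ω) :=
    (measurable_expectedDecrease hc _).comp (h.measurable 0)
  -- A finite constant factor moves inside without measurability of the hitting time.
  rw [← lintegral_const_mul' _ _ ENNReal.ofReal_ne_top]
  refine (lintegral_mono fun ω =>
    h.mul_evalsToSOSP_le hd hL₁ hL₂ hε hγ hγε hf hσ₁ hσ₂ ω).trans ?_
  rw [lintegral_add_right _ (hm.const_mul 3), lintegral_const_mul' _ _ (by norm_num),
    lintegral_const_mul' _ _ (by norm_num), show (9 : ℝ≥0∞) = 6 + 3 by norm_num, add_mul]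
  exact add_le_add (mul_le_mul' le_rfl (h.tsum_expectedDecrease_le hc hf.bddBelow))
    (mul_le_mul' le_rfl (lintegral_mono fun ω => expectedDecrease_le hf.bddBelow _ _))

end Main

end RandomSearch

theorem mainTheorem2 :
    ∃ C c : ℝ, 0 < C ∧ 0 < c ∧
      ∀ (d : ℕ) (_ : 1 ≤ d) (L₁ L₂ ε : ℝ) (_ : 0 < L₁) (_ : 0 < L₂) (_ : 0 < ε)
        (f : EuclideanSpace ℝ (Fin d) → ℝ) (_ : RandomSearch.SmoothnessAssumption f L₁ L₂)
        (σ₁ σ₂ κ : ℝ)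
        (_ : σ₁ = ε / (L₁ * Real.sqrt (2 * Real.pi * d)))
        (_ : σ₂ = ε ^ (2 / 3 : ℝ) / (2 * L₂))
        (_ : κ = c * max 1 (L₁ * ε ^ (-(2 / 3) : ℝ)))
        (Ω : Type*) [mΩ : MeasurableSpace Ω] (P : Measure Ω) [IsProbabilityMeasure P]
        (ℱ : Filtration ℕ mΩ)
        (s : ℕ → Ω → Metric.sphere (0 : EuclideanSpace ℝ (Fin d)) 1)
        (x : ℕ → Ω → EuclideanSpace ℝ (Fin d))
        (_ : RandomSearch.IsTwoStepRandomSearch P f σ₁ σ₂ ℱ s x),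
        ∫⁻ ω, RandomSearch.evalsToSOSP f ε (ε ^ (2 / 3 : ℝ)) σ₁ σ₂ s x ω ∂P ≤
          ENNReal.ofReal (C * (min L₁ (ε ^ (2 / 3 : ℝ)) + L₂ ^ 2) * (κ ^ d * (ε ^ 2)⁻¹)) *
            ∫⁻ ω, ENNReal.ofReal (f (x 0 ω) - ⨅ y, f y) ∂P := by

  -- `288 = 9 * 32`: `9 = 6 + 3` from the hitting bound, `32` from `guaranteedDecrease`; `96 = 4 *
  -- 24` from the curvature cap.
  refine ⟨288, 96, by norm_num, by norm_num, ?_⟩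
  intro d hd L₁ L₂ ε hL₁ hL₂ hε f hf σ₁ σ₂ κ hσ₁ hσ₂ hκ Ω mΩ P _ ℱ s x h
  set γ := ε ^ (2 / 3 : ℝ) with hγ_def
  have hγ : 0 < γ := Real.rpow_pos_of_pos hε _
  have hγε : γ ^ 3 = ε ^ 2 := by
    rw [hγ_def, ← Real.rpow_natCast, ← Real.rpow_mul hε.le, ← Real.rpow_natCast ε 2]
    norm_num
  have hκ' : κ = 96 * max 1 (L₁ / γ) := by
    rw [hκ, Real.rpow_neg hε.le, ← hγ_def, ← div_eq_mul_inv]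
  have key := h.mul_lintegral_evalsToSOSP_le hd hL₁ hL₂ hε hγ hγε hf hσ₁ hσ₂
  have hw := RandomSearch.guaranteedDecrease_pos (d := d) (L₂ := L₂) hL₁ hε hγ
  have hcoef : 288 * (min L₁ γ + L₂ ^ 2) * (κ ^ d * (ε ^ 2)⁻¹) =
      (RandomSearch.guaranteedDecrease d L₁ L₂ ε γ)⁻¹ * 9 := by
    rw [hκ', RandomSearch.guaranteedDecrease, inv_div]
    ring
  rw [hcoef, ENNReal.ofReal_mul (inv_nonneg.2 hw.le), ENNReal.ofReal_inv_of_pos hw, mul_assoc,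
    ENNReal.ofReal_ofNat, ← ENNReal.div_eq_inv_mul, ENNReal.le_div_iff_mul_le
      (Or.inl (ENNReal.ofReal_pos.2 hw).ne') (Or.inl ENNReal.ofReal_ne_top), mul_comm]
  exact key
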